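/- Let $V$ be a finite-dimensional real inner product space, let $a\le b$ be real numbers, and equip each tensor power $V^{\otimes k}$ ($V^{\otimes 0}=\mathbb R$) with the Hilbert–Schmidt inner product, $\langle v_1\otimes\cdots\otimes v_k,\,w_1\otimes\cdots\otimes w_k\rangle=\prod_i\langle v_i,w_i\rangle$. The signature of a continuous path $x:[a,b]\to V$ of bounded variation is the tensor series $S(x)=(S(x)^{(k)})_{k\ge 0}$ with $S(x)^{(0)}=1$ and $$S(x)^{(k)}=\int_{a<t_1<\cdots<t_k<b}dx_{t_1}\otimes\cdots\otimes dx_{t_k}\in V^{\otimes k}.$$ Let $\mathcal C$ be the space of unparameterised paths, i.e. the set of continuous paths of bounded variation $x:[a,b]\to V$ with $x_a=0$, where two paths are identified when they have the same signature. Let $\phi:\{0,1,2,\dots\}\to(0,\infty)$ be a weight function such that $\sum_{k\ge 0} C^k\phi(k)/(k!)^2<\infty$ for every $C>0$. Let $T_\phi((V))$ be the Hilbert space of tensor series $v=(v_k)_{k\ge0}$, $v_k\in V^{\otimes k}$, with $\sum_k\phi(k)\|v_k\|^2<\infty$ and inner product $\langle v,w\rangle_\phi=\sum_k\phi(k)\langle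 v_k,w_k\rangle$ (the completion of the tensor algebra of $V$ for this inner product); every signature lies in $T_\phi((V))$. Let $k_\phi(x,y)=\langle S(x),S(y)\rangle_\phi$ be the $\phi$-signature kernel on $\mathcal C$ and $\mathcal H_\phi$ the reproducing kernel Hilbert space of functions on $\mathcal C$ with kernel $k_\phi$. Assume that $\mathcal C$ carries a topology for which $S:\mathcal C\to T_\phi((V))$ is continuous for the norm topology, let $\mathcal K\subset\mathcal C$ be compact, and let $\mathcal P(\mathcal K)$ be the set of Borel probability measures on $\mathcal K$. For $\mu,\nu\in\mathcal P(\mathcal K)$ define the maximum mean discrepancy $$d_\phi(\mu,\nu)=\sup_{f\in\mathcal H_\phi,\ \|f\|\le 1}\Big(\int_{\mathcal K} f\,d\mu-\int_{\mathcal K} f\,d\nu\Big)$$ and the kernel mean embedding $M^\phi_\mu=\int_{\mathcal K}k_\phi(x,\cdot)\,\mu(dx)\in\mathcal H_\phi$ (a Bochner integral). Then all these integrals exist, the supremum is finite, and for all $\mu,\nu\in\mathcal P(\mathcal K)$ $$d_\phi(\mu,\nu)=0\iff\mu=\nu .$$ Moreover $k_\phi$ is characteristic to $\mathcal K$, i.e.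 the map $\mu\mapsto M^\phi_\mu$ is injective on $\mathcal P(\mathcal K)$. -/

import Mathlib

open MeasureTheory Set
open scoped TensorProduct InnerProductSpace ENNReal

noncomputable section

namespace SignatureKernel

universe u

/-! ### Tensor powers with the Hilbert-Schmidt inner product -/

/-- A finite-dimensional real inner product space, bundled. -/
structure HilbertBundle where
  carrier : Type u
  [group : NormedAddCommGroup carrier]
  [inner : InnerProductSpace ℝ carrier]
  [finite : FiniteDimensional ℝ carrier]

attribute [instance] HilbertBundle.group HilbertBundle.inner HilbertBundle.finite

variable (V : Type u) [NormedAddCommGroup V] [InnerProductSpace ℝ V] [FiniteDimensional ℝ V]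

/-- The tensor powers of `V`, by recursion: the zeroth one is the real line (written as a
one-dimensional Euclidean space so that it lives in the universe of `V`), and the next one is
the tensor product with `V`, with the inner product
`⟪v₁ ⊗ w₁, v₂ ⊗ w₂⟫ = ⟪v₁, v₂⟫ * ⟪w₁, w₂⟫`. -/
def tensorBundle : ℕ → HilbertBundle.{u}
  | 0 => ⟨EuclideanSpace ℝ PUnit.{u + 1}⟩
  | k + 1 => ⟨(tensorBundle k).carrier ⊗[ℝ] V⟩

/-- The `k`-fold tensor power of `V`. -/
abbrev TPow (k : ℕ) : Type u := (tensorBundle V k).carrier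

/-- The unit `1` of the zeroth tensor power. -/
def tensorUnit : TPow V 0 :=
  (EuclideanSpace.single PUnit.unit 1 : EuclideanSpace ℝ PUnit.{u + 1})

/-- The bilinear map `(v, w) ↦ v ⊗ w` from the `k`-th tensor power and `V` to the next one. -/
def tensorMul (k : ℕ) : TPow V k →L[ℝ] V →L[ℝ] TPow V (k + 1) :=
  TensorProduct.mkL ℝ (TPow V k) V

/-! ### Paths of bounded variation and their signature -/

/-- Continuous paths of bounded variation on `[a, b]` that start at zero. -/
structure BVPath (a b : ℝ) [Fact (a ≤ b)] where
  toFun : Icc a b → V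
  continuous_toFun : Continuous toFun
  boundedVariation : BoundedVariationOn toFun univ
  map_bot : toFun ⊥ = 0

variable {V} {a b : ℝ} [Fact (a ≤ b)]

/-- The vector-valued Lebesgue-Stieltjes measure `dx` of a path `x`. -/
def BVPath.stieltjes (x : BVPath V a b) : VectorMeasure (Icc a b) V :=
  x.boundedVariation.vectorMeasure

/-- The iterated integrals over `[a, t]`: the level `k + 1` at time `t` is the integral
of `S(x)^{(k)}_{[a, s]} ⊗ dx_s` over `s` in `[a, t]`. -/
def BVPath.iterInt (x : BVPath V a b) : (k : ℕ) → Icc a b → TPow V k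
  | 0 => fun _ => tensorUnit V
  | k + 1 => fun t =>
      (x.stieltjes.restrict (Iic t)).integral (BVPath.iterInt x k) (tensorMul V k)

/-- The signature of a path over the whole interval, as a formal tensor series. -/
def BVPath.sig (x : BVPath V a b) (k : ℕ) : TPow V k := x.iterInt k ⊤

/-! ### Factorial decay of the signature -/

theorem isFiniteMeasure_variation {X : Type*} [MeasurableSpace X] (μ : VectorMeasure X V) :
    IsFiniteMeasure μ.variation := by
  classical
  let e := stdOrthonormalBasis ℝ V
  let c : Fin (Module.finrank ℝ V) → SignedMeasure X := fun i =>
    μ.mapRange (innerSL ℝ (e i) : V →L[ℝ] ℝ).toLinearMap.toAddMonoidHom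
      (innerSL ℝ (e i) : V →L[ℝ] ℝ).continuous
  have hfin : ∀ i, IsFiniteMeasure (c i).variation := fun i => by
    rw [← SignedMeasure.totalVariation_eq_variation]; infer_instance
  have hle : μ.variation ≤ ∑ i, (c i).variation := by
    refine VectorMeasure.variation_le_of_forall_enorm_le fun s _ => ?_
    have h1 : μ s = ∑ i, c i s • e i := (e.sum_repr' (μ s)).symm
    calc ‖μ s‖ₑ = ‖∑ i, c i s • e i‖ₑ := by rw [← h1]
      _ ≤ ∑ i, ‖c i s • e i‖ₑ := enorm_sum_le _ _
      _ = ∑ i, ‖c i s‖ₑ := by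
        refine Finset.sum_congr rfl fun i _ => ?_
        rw [enorm_smul, ← ofReal_norm (e i), e.norm_eq_one]; simp
      _ ≤ ∑ i, (c i).variation s :=
        Finset.sum_le_sum fun i _ => VectorMeasure.enorm_measure_le_variation _ _
      _ = (∑ i, (c i).variation) s := by simp
  exact isFiniteMeasure_of_le _ hle

theorem BVPath.variation_singleton (x : BVPath V a b) (t : Icc a b) :
    x.stieltjes.variation {t} = 0 := by
  refine (VectorMeasure.variation_apply_eq_zero (measurableSet_singleton t)).2 fun s hs _ => ?_
  rcases subset_singleton_iff_eq.1 hs with rfl | rfl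
  · simp
  · rw [BVPath.stieltjes, BoundedVariationOn.vectorMeasure_singleton,
      x.continuous_toFun.continuousWithinAt.leftLim_eq,
      x.continuous_toFun.continuousWithinAt.rightLim_eq, sub_self]

theorem continuous_measureReal_Iic {c d : ℝ} (m : Measure (Icc c d)) [IsFiniteMeasure m]
    (hm : ∀ t, m {t} = 0) : Continuous fun t => m.real (Iic t) := by
  have h : (fun t => m.real (Iic t)) =
      fun t => ∫ s, (Iic t).indicator (fun _ => (1 : ℝ)) s ∂m := by
    funext t
    rw [integral_indicator measurableSet_Iic]; simp
  rw [h]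
  refine continuous_iff_continuousAt.2 fun t₀ => ?_
  refine tendsto_integral_filter_of_dominated_convergence (fun _ => 1)
    (Filter.Eventually.of_forall fun t =>
      (aestronglyMeasurable_const.indicator measurableSet_Iic))
    (Filter.Eventually.of_forall fun t => Filter.Eventually.of_forall fun s => ?_)
    (integrable_const _) ?_
  · by_cases hs : s ∈ Iic t <;> simp [hs]
  · have h0 : ∀ᵐ s ∂m, s ≠ t₀ := by
      rw [ae_iff]; simpa using hm t₀
    filter_upwards [h0] with s hs
    refine tendsto_const_nhds.congr' ?_
    rcases lt_or_gt_of_ne hs with hs | hs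
    · filter_upwards [lt_mem_nhds hs] with t ht
      simp [ht.le, hs.le]
    · filter_upwards [gt_mem_nhds hs] with t ht
      simp [ht.not_ge, hs.not_ge]

theorem map_measureReal_Iic (m : Measure (Icc a b)) [IsFiniteMeasure m]
    (hm : ∀ t, m {t} = 0) (t : Icc a b) :
    (m.restrict (Iic t)).map (fun s => m.real (Iic s)) =
      volume.restrict (Icc 0 (m.real (Iic t))) := by
  have hcont := continuous_measureReal_Iic m hm
  have hmono : Monotone fun s => m.real (Iic s) := fun s s' h =>
    measureReal_mono (Iic_subset_Iic.2 h)
  have hbot : m.real (Iic (⊥ : Icc a b)) = 0 := by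
    rw [Iic_bot, measureReal_def, hm]; simp
  have hnn : ∀ s, 0 ≤ m.real (Iic s) := fun s => measureReal_nonneg
  have : IsFiniteMeasure ((m.restrict (Iic t)).map (fun s => m.real (Iic s))) :=
    Measure.isFiniteMeasure_map _ _
  refine Measure.ext_of_Iic _ _ fun c => ?_
  rw [Measure.map_apply hcont.measurable measurableSet_Iic,
    Measure.restrict_apply (hcont.measurable measurableSet_Iic),
    Measure.restrict_apply measurableSet_Iic]
  rcases lt_or_ge c 0 with hc | hc
  · have h1 : (fun s => m.real (Iic s)) ⁻¹' Iic c = ∅ := by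
      ext s; simpa using hc.trans_le (hnn s)
    have h2 : Iic c ∩ Icc 0 (m.real (Iic t)) = ∅ := by
      ext y; simp only [mem_inter_iff, mem_Iic, mem_Icc, mem_empty_iff_false, iff_false]
      rintro ⟨h, h', -⟩; linarith
    rw [h1, h2]; simp
  rcases le_or_gt (m.real (Iic t)) c with hct | hct
  · have h1 : (fun s => m.real (Iic s)) ⁻¹' Iic c ∩ Iic t = Iic t :=
      inter_eq_right.2 fun s hs => (hmono hs).trans hct
    have h2 : Iic c ∩ Icc 0 (m.real (Iic t)) = Icc 0 (m.real (Iic t)) :=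
      inter_eq_right.2 fun y hy => hy.2.trans hct
    rw [h1, h2, Real.volume_Icc, sub_zero, measureReal_def, ENNReal.ofReal_toReal]
    exact measure_ne_top _ _
  · have hcl : IsClosed ((fun s => m.real (Iic s)) ⁻¹' Iic c) := isClosed_Iic.preimage hcont
    obtain ⟨u, hu, hmax⟩ := hcl.isCompact.exists_isGreatest ⟨⊥, hbot.trans_le hc⟩
    obtain ⟨w, hw⟩ := mem_range_of_exists_le_of_exists_ge hcont
      ⟨⊥, hbot.trans_le hc⟩ ⟨t, hct.le⟩
    have huc : m.real (Iic u) = c :=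
      le_antisymm hu (hw.symm.le.trans (hmono (hmax (show m.real (Iic w) ≤ c from hw.le))))
    have hut : u ≤ t := by
      by_contra h
      exact absurd ((hmono (not_le.1 h).le).trans_eq huc) (not_le.2 hct)
    have h1 : (fun s => m.real (Iic s)) ⁻¹' Iic c ∩ Iic t = Iic u := by
      ext s
      refine ⟨fun h => hmax h.1, fun h => ⟨(hmono h).trans_eq huc, le_trans h hut⟩⟩
    have h2 : Iic c ∩ Icc 0 (m.real (Iic t)) = Icc 0 c := by
      ext y
      exact ⟨fun h => ⟨h.2.1, h.1⟩, fun h => ⟨h.2, h.1, h.2.trans hct.le⟩⟩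
    rw [h1, h2, Real.volume_Icc, sub_zero, ← huc, measureReal_def, ENNReal.ofReal_toReal]
    exact measure_ne_top _ _

theorem lintegral_pow_measure_Iic (m : Measure (Icc a b)) [IsFiniteMeasure m]
    (hm : ∀ t, m {t} = 0) (k : ℕ) (t : Icc a b) :
    ∫⁻ s in Iic t, ENNReal.ofReal (m.real (Iic s) ^ k / k.factorial) ∂m =
      ENNReal.ofReal (m.real (Iic t) ^ (k + 1) / (k + 1).factorial) := by
  have hcont := continuous_measureReal_Iic m hm
  have h0 : 0 ≤ m.real (Iic t) := measureReal_nonneg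
  have h1 : ∫⁻ s in Iic t, ENNReal.ofReal (m.real (Iic s) ^ k / k.factorial) ∂m =
      ∫⁻ y in Icc 0 (m.real (Iic t)), ENNReal.ofReal (y ^ k / k.factorial) := by
    rw [← map_measureReal_Iic m hm t, lintegral_map (by fun_prop) hcont.measurable]
  rw [h1, ← ofReal_integral_eq_lintegral_ofReal]
  · rw [integral_Icc_eq_integral_Ioc, ← intervalIntegral.integral_of_le h0,
      intervalIntegral.integral_div, integral_pow, Nat.factorial_succ]
    congr 1
    push_cast
    field_simp
    simp
  · exact (Continuous.integrableOn_Icc (by fun_prop))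
  · filter_upwards [ae_restrict_mem measurableSet_Icc] with y hy
    have := hy.1
    positivity

theorem norm_tensorMul_le (k : ℕ) : ‖tensorMul V k‖ ≤ 1 :=
  LinearMap.mkContinuous₂_norm_le _ zero_le_one fun _ _ => by simp

theorem BVPath.enorm_iterInt_le (x : BVPath V a b) (k : ℕ) (t : Icc a b) :
    ‖x.iterInt k t‖ₑ ≤
      ENNReal.ofReal (x.stieltjes.variation.real (Iic t) ^ k / k.factorial) := by
  have := isFiniteMeasure_variation x.stieltjes
  induction k generalizing t with
  | zero =>
    have h : ‖x.iterInt 0 t‖ = 1 := by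
      show ‖(EuclideanSpace.single PUnit.unit 1 : EuclideanSpace ℝ PUnit.{u + 1})‖ = 1
      simp
    rw [← ofReal_norm, h]; simp
  | succ k ih =>
    rw [← lintegral_pow_measure_Iic _ x.variation_singleton]
    have hB : ‖tensorMul V k‖ₑ ≤ 1 := by
      rw [← ofReal_norm, ← ENNReal.ofReal_one]
      exact ENNReal.ofReal_le_ofReal (norm_tensorMul_le k)
    calc ‖x.iterInt (k + 1) t‖ₑ
        ≤ ‖tensorMul V k‖ₑ * ∫⁻ s, ‖x.iterInt k s‖ₑ ∂(x.stieltjes.restrict (Iic t)).variation :=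
          VectorMeasure.enorm_integral_le_lintegral_enorm
      _ ≤ 1 * ∫⁻ s in Iic t, ENNReal.ofReal
            (x.stieltjes.variation.real (Iic s) ^ k / k.factorial) ∂x.stieltjes.variation := by
          rw [VectorMeasure.variation_restrict measurableSet_Iic]
          gcongr with s
          exact ih s
      _ = _ := one_mul _

/-- The factorial decay of the levels of the signature. -/
theorem BVPath.exists_norm_sig_le (x : BVPath V a b) :
    ∃ C : ℝ, 0 < C ∧ ∀ k, ‖x.sig k‖ ≤ C ^ k / k.factorial := by
  refine ⟨x.stieltjes.variation.real (Iic ⊤) + 1, by positivity, fun k => ?_⟩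
  have h0 : 0 ≤ x.stieltjes.variation.real (Iic ⊤) := measureReal_nonneg
  have h := x.enorm_iterInt_le k ⊤
  rw [← ofReal_norm, ENNReal.ofReal_le_ofReal_iff (by positivity)] at h
  refine h.trans ?_
  gcongr
  linarith

/-! ### Unparameterised paths -/

variable (V a b) in
/-- Two paths are identified when they have the same signature. -/
def sigSetoid : Setoid (BVPath V a b) where
  r x y := x.sig = y.sig
  iseqv := ⟨fun _ => rfl, fun h => h.symm, fun h h' => h.trans h'⟩

variable (V a b) in
/-- The space of unparameterised paths. It carries no topology of its own. -/
def UnparamPath : Type u := Quotient (sigSetoid V a b)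

/-- The signature of an unparameterised path. -/
def UnparamPath.sig (x : UnparamPath V a b) : (k : ℕ) → TPow V k :=
  Quotient.lift BVPath.sig (fun _ _ h => h) x

theorem UnparamPath.exists_norm_sig_le (x : UnparamPath V a b) :
    ∃ C : ℝ, 0 < C ∧ ∀ k, ‖x.sig k‖ ≤ C ^ k / k.factorial :=
  Quotient.inductionOn x fun y => y.exists_norm_sig_le

/-! ### The weighted tensor space -/

/-- Positive weights `φ` with `∑ C ^ k φ(k) / (k!)²` convergent for all `C > 0`. -/
structure Weight where
  toFun : ℕ → ℝ
  pos : ∀ k, 0 < toFun k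
  summable : ∀ C : ℝ, 0 < C → Summable fun k : ℕ => C ^ k * toFun k / (k.factorial : ℝ) ^ 2

instance : CoeFun Weight (fun _ => ℕ → ℝ) := ⟨Weight.toFun⟩

theorem summable_inner (φ : Weight) {v w : (k : ℕ) → TPow V k}
    (hv : Summable fun k => φ k * ‖v k‖ ^ 2) (hw : Summable fun k => φ k * ‖w k‖ ^ 2) :
    Summable fun k => φ k * ⟪v k, w k⟫_ℝ := by
  refine Summable.of_norm_bounded (hv.add hw) fun k => ?_
  rw [norm_mul, Real.norm_of_nonneg (φ.pos k).le, ← mul_add]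
  refine mul_le_mul_of_nonneg_left ?_ (φ.pos k).le
  nlinarith [norm_inner_le_norm (𝕜 := ℝ) (v k) (w k), sq_nonneg (‖v k‖ - ‖w k‖),
    sq_nonneg (‖v k‖), sq_nonneg ‖w k‖]

variable (V) in
/-- The tensor series `v` with `∑ φ(k) ‖v_k‖² < ∞`. -/
def weightedSubmodule (φ : Weight) : Submodule ℝ ((k : ℕ) → TPow V k) where
  carrier := {v | Summable fun k => φ k * ‖v k‖ ^ 2}
  zero_mem' := by simp [summable_zero]
  add_mem' := fun {v w} hv hw => by
    have h := (hv.add hw).add ((summable_inner φ hv hw).mul_left 2)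
    refine h.congr fun k => ?_
    rw [Pi.add_apply, norm_add_sq_real]; ring
  smul_mem' := fun c v hv => by
    refine (Summable.mul_left (c ^ 2) hv).congr fun k => ?_
    rw [Pi.smul_apply, norm_smul, mul_pow, Real.norm_eq_abs, sq_abs]; ring

variable (V) in
/-- The Hilbert space `T_φ((V))`, the completion of the tensor algebra of `V` for the inner product
`∑ φ(k) ⟪v_k, w_k⟫`, realised as the space of tensor series of finite norm. -/
def WeightedTensor (φ : Weight) : Type u := weightedSubmodule V φ

namespace WeightedTensor

variable {φ : Weight}

instance : AddCommGroup (WeightedTensor V φ) :=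
  inferInstanceAs (AddCommGroup (weightedSubmodule V φ))

instance : Module ℝ (WeightedTensor V φ) :=
  inferInstanceAs (Module ℝ (weightedSubmodule V φ))

/-- The `k`-th component of a tensor series. -/
def coord (v : WeightedTensor V φ) (k : ℕ) : TPow V k := v.1 k

@[simp] theorem coord_add (v w : WeightedTensor V φ) (k : ℕ) :
    (v + w).coord k = v.coord k + w.coord k := rfl

@[simp] theorem coord_smul (c : ℝ) (v : WeightedTensor V φ) (k : ℕ) :
    (c • v).coord k = c • v.coord k := rfl

theorem summable_coord (v : WeightedTensor V φ) : Summable fun k => φ k * ‖v.coord k‖ ^ 2 := v.2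

/-- The `φ`-inner product. -/
@[reducible] def core : InnerProductSpace.Core ℝ (WeightedTensor V φ) where
  inner v w := ∑' k, φ k * ⟪v.coord k, w.coord k⟫_ℝ
  conj_inner_symm v w := by
    simp [real_inner_comm]
  re_inner_nonneg v := by
    refine tsum_nonneg fun k => mul_nonneg (φ.pos k).le real_inner_self_nonneg
  add_left u v w := by
    refine Eq.trans (tsum_congr fun k => ?_)
      ((summable_inner φ u.2 w.2).tsum_add (summable_inner φ v.2 w.2))
    rw [coord_add, inner_add_left, mul_add]; rfl
  smul_left v w c := by
    rw [conj_trivial, ← tsum_mul_left]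
    exact tsum_congr fun k => by rw [coord_smul, real_inner_smul_left]; ring
  definite v hv := by
    have hs := summable_inner φ v.2 v.2
    have h0 : ∀ k, 0 ≤ φ k * ⟪v.1 k, v.1 k⟫_ℝ := fun k =>
      mul_nonneg (φ.pos k).le real_inner_self_nonneg
    have h := (hasSum_zero_iff_of_nonneg h0).1 (hv ▸ hs.hasSum)
    refine Subtype.ext (funext fun k => ?_)
    have hk := congrFun h k
    have hk' : v.1 k = 0 := by simpa [(φ.pos k).ne'] using hk
    exact hk'

instance : NormedAddCommGroup (WeightedTensor V φ) :=
  InnerProductSpace.Core.toNormedAddCommGroup (cd := core)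

instance : InnerProductSpace ℝ (WeightedTensor V φ) := InnerProductSpace.ofCore core.toCore

theorem inner_def (v w : WeightedTensor V φ) :
    ⟪v, w⟫_ℝ = ∑' k, φ k * ⟪v.coord k, w.coord k⟫_ℝ := rfl

end WeightedTensor

theorem UnparamPath.sig_mem (φ : Weight) (x : UnparamPath V a b) :
    x.sig ∈ weightedSubmodule V φ := by
  obtain ⟨C, hC, h⟩ := x.exists_norm_sig_le
  refine Summable.of_nonneg_of_le (fun k => mul_nonneg (φ.pos k).le (sq_nonneg _)) (fun k => ?_)
    (φ.summable (C ^ 2) (by positivity))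
  calc φ k * ‖x.sig k‖ ^ 2 ≤ φ k * (C ^ k / k.factorial) ^ 2 := by
        have := h k; have := (φ.pos k).le; gcongr
    _ = (C ^ 2) ^ k * φ k / (k.factorial : ℝ) ^ 2 := by ring

/-- The signature transform as a map from unparameterised paths to `T_φ((V))`. -/
def signature (φ : Weight) (x : UnparamPath V a b) : WeightedTensor V φ := ⟨x.sig, x.sig_mem φ⟩

/-! ### The signature kernel and its reproducing kernel Hilbert space -/

/-- The `φ`-signature kernel. -/
def sigKernel (φ : Weight) (x y : UnparamPath V a b) : ℝ := ⟪signature φ x, signature φ y⟫_ℝ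

variable (V a b) in
/-- The kernel as a matrix of operators on `ℝ`, acting by multiplication. -/
def kernelMatrix (φ : Weight) : Matrix (UnparamPath V a b) (UnparamPath V a b) (ℝ →L[ℝ] ℝ) :=
  .of fun x y => sigKernel φ x y • ContinuousLinearMap.id ℝ ℝ

theorem posSemidef_kernelMatrix (φ : Weight) : (kernelMatrix V a b φ).PosSemidef := by
  have htfae := (RKHS.posSemidef_tfae (K := kernelMatrix V a b φ)).out 0 2
  refine htfae.2 ⟨?_, fun f => ?_⟩
  · have hid : star (ContinuousLinearMap.id ℝ ℝ) = ContinuousLinearMap.id ℝ ℝ :=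
      star_one (ℝ →L[ℝ] ℝ)
    ext x y
    simp [kernelMatrix, sigKernel, real_inner_comm, Matrix.conjTranspose_apply, hid]
  · have h : (f.sum fun x w => f.sum fun x' w' => ⟪kernelMatrix V a b φ x' x w, w'⟫_ℝ) =
        ⟪f.sum fun x w => w • signature φ x, f.sum fun x w => w • signature φ x⟫_ℝ := by
      simp only [Finsupp.sum_inner, Finsupp.inner_sum]
      refine Finsupp.sum_congr fun x _ => Finsupp.sum_congr fun y _ => ?_
      rw [real_inner_smul_left, real_inner_smul_right, real_inner_comm]
      simp [kernelMatrix, sigKernel]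
      ring
    rw [h]
    exact inner_self_nonneg

instance (φ : Weight) : Fact (kernelMatrix V a b φ).PosSemidef := ⟨posSemidef_kernelMatrix φ⟩

variable (V a b) in
/-- The reproducing kernel Hilbert space of functions on unparameterised paths whose reproducing
kernel is the `φ`-signature kernel. -/
abbrev SigRKHS (φ : Weight) : Type u := RKHS.OfKernel (kernelMatrix V a b φ)

/-- The element `k_φ(x, ·)` of the reproducing kernel Hilbert space. -/
def kernelSection (φ : Weight) (x : UnparamPath V a b) : SigRKHS V a b φ :=
  RKHS.kerFun (SigRKHS V a b φ) x 1

theorem inner_kernelSection (φ : Weight) (x y : UnparamPath V a b) :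
    ⟪kernelSection φ x, kernelSection φ y⟫_ℝ = sigKernel φ x y := by
  rw [kernelSection, kernelSection, ← RKHS.kernel_inner, RKHS.OfKernel.kernel_ofKernel]
  simp [kernelMatrix, sigKernel, real_inner_comm]

theorem kernelSection_apply (φ : Weight) (x y : UnparamPath V a b) :
    kernelSection φ x y = sigKernel φ x y := by
  rw [kernelSection, RKHS.kerFun_apply, RKHS.OfKernel.kernel_ofKernel]
  simp [kernelMatrix, sigKernel, real_inner_comm]

/-! ### Maximum mean discrepancy and kernel mean embedding -/

variable [TopologicalSpace (UnparamPath V a b)] [MeasurableSpace (UnparamPath V a b)]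
  {K : Set (UnparamPath V a b)}

/-- The differences of expectations `E_μ f - E_ν f` over the unit ball of the reproducing kernel
Hilbert space. -/
def mmdSet (φ : Weight) (μ ν : ProbabilityMeasure K) : Set ℝ :=
  (fun f : SigRKHS V a b φ => ∫ x : K, f x ∂(μ : Measure K) - ∫ y : K, f y ∂(ν : Measure K)) ''
    {f | ‖f‖ ≤ 1}

/-- The maximum mean discrepancy `d_φ(μ, ν)`. -/
def mmd (φ : Weight) (μ ν : ProbabilityMeasure K) : ℝ := sSup (mmdSet φ μ ν)

/-- The kernel mean embedding `E_μ k_φ(x, ·)`, a Bochner integral in the reproducing kernel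
Hilbert space. -/
def kernelMean (φ : Weight) (μ : ProbabilityMeasure K) : SigRKHS V a b φ :=
  ∫ x : K, kernelSection φ (x : UnparamPath V a b) ∂(μ : Measure K)

variable (K) in
/-- The kernel is characteristic to `K`: the kernel mean embedding is injective on the Borel
probability measures on `K`. -/
def IsCharacteristic (φ : Weight) : Prop :=
  Function.Injective fun μ : ProbabilityMeasure K => kernelMean φ μ

end SignatureKernel
end

open MeasureTheory Set
open scoped TensorProduct InnerProductSpace ENNReal

noncomputable section

namespace SignatureKernel

universe u

/-! By the reproducing property, integrating `f` against `μ` is pairing `f` with the kernel mean of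
`μ`. The supremum over the unit ball is therefore the norm of the difference of the two kernel means
(`mmd_eq_norm`), and everything reduces to injectivity of the embedding (`isCharacteristic`).

If two kernel means agree, pairing them with kernel sections shows that the difference of the
expected signatures is orthogonal to the signature of every path in `K`. Being a difference of
integrals of such signatures, it is orthogonal to itself, hence zero
(`integral_inner_sig_eq_of_integral_sigKernel_eq`). Expected signatures determine the measure by
Stone–Weierstrass (`eq_of_integral_inner_sig_eq`): coordinates of the signature are continuous on
`K`, they separate points because paths with equal signatures are identified, and their span is an
algebra.

The algebra property (`mul_mem_coordSpan`) is the shuffle identity, proved here without the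
combinatorics of shuffles. The coordinate along a pure tensor `u ⊗ z` is a scalar integral of the
coordinate along `u` against a bounded density of `⟪z, dx⟫`. Integration by parts writes a product
of two such integrals as a sum of two integrals of products of lower total level, and induction
applies. The recursion integrates over the end time, so the functions involved depend on the path
and on the time. -/

/-! ### Scalar densities of vector measures and integration by parts -/

/-- The scalar measure `⟪z, μ⟫` has a density, bounded by `‖z‖`, with respect to the variation. -/
theorem exists_density {X V : Type*} [MeasurableSpace X] [NormedAddCommGroup V]
    [InnerProductSpace ℝ V] (μ : VectorMeasure X V) [IsFiniteMeasure μ.variation] (z : V) :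
    ∃ h : X → ℝ, Measurable h ∧ (∀ x, |h x| ≤ ‖z‖) ∧
      ∀ s, MeasurableSet s → ⟪z, μ s⟫_ℝ = ∫ x in s, h x ∂μ.variation := by
  let m := μ.variation
  let c : SignedMeasure X := μ.mapRange (innerSL ℝ z : V →L[ℝ] ℝ).toLinearMap.toAddMonoidHom
    (innerSL ℝ z : V →L[ℝ] ℝ).continuous
  have hc : ∀ s, c s = ⟪z, μ s⟫_ℝ := fun s => rfl
  have hle : ∀ s, |c s| ≤ ‖z‖ * m.real s := fun s => by
    rw [hc]
    exact (abs_real_inner_le_norm _ _).trans (mul_le_mul_of_nonneg_left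
      (VectorMeasure.norm_measure_le_variation (measure_ne_top _ _)) (norm_nonneg z))
  have hac : c ≪ᵥ m.toENNRealVectorMeasure := by
    refine VectorMeasure.AbsolutelyContinuous.mk fun s hs h => ?_
    rw [Measure.toENNRealVectorMeasure_apply_measurable hs] at h
    have := hle s
    rw [measureReal_def, h] at this
    simpa using this
  have hd := SignedMeasure.withDensityᵥ_rnDeriv_eq c m hac
  have hi : Integrable (c.rnDeriv m) m := SignedMeasure.integrable_rnDeriv c m
  have hs : ∀ s, MeasurableSet s → c s = ∫ x in s, c.rnDeriv m x ∂m := fun s hs => by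
    conv_lhs => rw [← hd]
    exact withDensityᵥ_apply hi hs
  have hub : c.rnDeriv m ≤ᵐ[m] fun _ => ‖z‖ := by
    refine ae_le_of_forall_setIntegral_le hi (integrable_const _) fun s hms _ => ?_
    rw [← hs s hms]
    refine (le_abs_self _).trans ((hle s).trans_eq ?_)
    simp [mul_comm]
  have hlb : (fun _ => -‖z‖) ≤ᵐ[m] c.rnDeriv m := by
    refine ae_le_of_forall_setIntegral_le (integrable_const _) hi fun s hms _ => ?_
    rw [← hs s hms]
    refine le_trans ?_ (neg_le_of_abs_le (hle s))
    simp [mul_comm]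
  -- The Radon–Nikodym derivative obeys the bound only almost everywhere; clamping it to `[-‖z‖,
  -- ‖z‖]` makes the bound hold at every point and changes no integral.
  refine ⟨fun x => max (-‖z‖) (min ‖z‖ (c.rnDeriv m x)), ?_, fun x => ?_, fun s hms => ?_⟩
  · exact measurable_const.max (measurable_const.min (SignedMeasure.measurable_rnDeriv c m))
  · have := norm_nonneg z
    exact abs_le.2 ⟨le_max_left _ _, max_le (by linarith) (min_le_left _ _)⟩
  · rw [← hc, hs s hms]
    refine integral_congr_ae (ae_restrict_of_ae ?_)
    filter_upwards [hub, hlb] with x h1 h2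
    rw [min_eq_right h1, max_eq_right h2]

/-- The integral of a vector-valued function against a vector measure, for a rank one pairing,
in terms of the density of the measure. -/
theorem integral_eq_integral_mul_density {X E V : Type*} [MeasurableSpace X]
    [NormedAddCommGroup E] [NormedSpace ℝ E] [NormedAddCommGroup V] [InnerProductSpace ℝ V]
    {μ : VectorMeasure X V} [IsFiniteMeasure μ.variation] {z : V} {h : X → ℝ}
    (hm : Measurable h) (hb : ∀ x, |h x| ≤ ‖z‖)
    (hs : ∀ s, MeasurableSet s → ⟪z, μ s⟫_ℝ = ∫ x in s, h x ∂μ.variation)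
    {B : E →L[ℝ] V →L[ℝ] ℝ} {l : E →L[ℝ] ℝ} (hB : ∀ e v, B e v = l e * ⟪z, v⟫_ℝ)
    {f : X → E} (hf : Integrable f μ.variation) :
    μ.integral f B = ∫ x, l (f x) * h x ∂μ.variation := by
  have hint : ∀ {g : X → E}, Integrable g μ.variation →
      Integrable (fun x => l (g x) * h x) μ.variation := fun hg =>
    (l.integrable_comp hg).mul_bdd hm.aestronglyMeasurable
      (Filter.Eventually.of_forall fun x => hb x)
  -- Both sides are additive and continuous in `f` for the `L¹` norm, so indicators of measurable
  -- sets with constant values suffice.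
  refine hf.induction
    (P := fun f => μ.integral f B = ∫ x, l (f x) * h x ∂μ.variation) ?_ ?_ ?_ ?_
  · intro c s hms _
    rw [VectorMeasure.integral_indicator_const c hms, hB, hs s hms, ← integral_const_mul,
      ← integral_indicator hms]
    congr 1
    ext x
    by_cases hx : x ∈ s <;> simp [hx]
  · intro f g _ hf hg hf' hg'
    rw [VectorMeasure.integral_add hf hg, hf', hg', ← integral_add (hint hf) (hint hg)]
    simp [add_mul]
  · refine isClosed_eq VectorMeasure.continuous_integral ?_
    have key : ∀ F : Lp E 1 μ.variation, ∫ x, l (F x) * h x ∂μ.variation =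
        ∫ x, (l.compLp F) x * h x ∂μ.variation := fun F => by
      refine integral_congr_ae ?_
      filter_upwards [l.coeFn_compLp F] with x hx
      rw [hx]
    have hcont : Continuous fun G : Lp ℝ 1 μ.variation => ∫ x, G x * h x ∂μ.variation := by
      refine (LipschitzWith.of_dist_le_mul (K := ‖z‖₊) fun G G' => ?_).continuous
      have hi : ∀ G : Lp ℝ 1 μ.variation, Integrable (fun x => G x * h x) μ.variation := fun G =>
        (L1.integrable_coeFn G).mul_bdd hm.aestronglyMeasurable
          (Filter.Eventually.of_forall fun x => hb x)
      rw [dist_eq_norm, ← integral_sub (hi G) (hi G'), dist_eq_norm, L1.norm_eq_integral_norm,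
        coe_nnnorm, ← integral_const_mul]
      refine norm_integral_le_of_norm_le ((L1.integrable_coeFn _).norm.const_mul _) ?_
      filter_upwards [Lp.coeFn_sub G G'] with x hx
      rw [hx, Pi.sub_apply, ← sub_mul, norm_mul, mul_comm]
      exact mul_le_mul_of_nonneg_right (hb x) (norm_nonneg _)
    simp_rw [key]
    exact hcont.comp (l.compLpL 1 μ.variation).continuous
  · intro f g hfg _ hf
    rw [← VectorMeasure.integral_congr_ae hfg, hf]
    refine integral_congr_ae ?_
    filter_upwards [hfg] with x hx
    rw [hx]

/-- Integration by parts for absolutely continuous functions with respect to an atomless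
measure. -/
theorem setIntegral_Iic_mul_setIntegral_Iic {T : Type*} [LinearOrder T] [TopologicalSpace T]
    [OrderClosedTopology T] [SecondCountableTopology T] [MeasurableSpace T] [BorelSpace T]
    {m : Measure T} [IsFiniteMeasure m] [NullSingletonClass m] {f g : T → ℝ}
    (hf : Integrable f m) (hg : Integrable g m) (t : T) :
    (∫ s in Iic t, f s ∂m) * ∫ s in Iic t, g s ∂m =
      (∫ s in Iic t, f s * ∫ r in Iic s, g r ∂m ∂m) +
        ∫ s in Iic t, g s * ∫ r in Iic s, f r ∂m ∂m := by
  let n := m.restrict (Iic t)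
  have hfg : Integrable (fun p : T × T => f p.1 * g p.2) (n.prod n) :=
    hf.restrict.mul_prod hg.restrict
  let D : Set (T × T) := {p | p.2 ≤ p.1}
  have hD : MeasurableSet D := measurableSet_le measurable_snd measurable_fst
  have hmain : (∫ s, f s ∂n) * ∫ s, g s ∂n = ∫ p, f p.1 * g p.2 ∂(n.prod n) :=
    (integral_prod_mul f g).symm
  have h1 : ∫ p in D, f p.1 * g p.2 ∂(n.prod n) =
      ∫ s in Iic t, f s * ∫ r in Iic s, g r ∂m ∂m := by
    rw [← integral_indicator hD, integral_prod _ (hfg.indicator hD)]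
    refine setIntegral_congr_fun measurableSet_Iic fun s hs => ?_
    have : ∀ r, D.indicator (fun p : T × T => f p.1 * g p.2) (s, r) =
        f s * (Iic s).indicator g r := fun r => by
      by_cases hr : r ≤ s <;> simp [D, indicator, hr]
    simp_rw [this]
    rw [integral_const_mul, integral_indicator measurableSet_Iic,
      Measure.restrict_restrict measurableSet_Iic, inter_eq_left.2 (Iic_subset_Iic.2 hs)]
  have h2 : ∫ p in Dᶜ, f p.1 * g p.2 ∂(n.prod n) =
      ∫ s in Iic t, g s * ∫ r in Iic s, f r ∂m ∂m := by
    rw [← integral_indicator hD.compl, integral_prod_symm _ (hfg.indicator hD.compl)]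
    refine setIntegral_congr_fun measurableSet_Iic fun s hs => ?_
    -- The complementary triangle is strict and yields `Iio s`; replacing it by `Iic s` is where the
    -- absence of atoms enters.
    have : ∀ r, Dᶜ.indicator (fun p : T × T => f p.1 * g p.2) (r, s) =
        g s * (Iio s).indicator f r := fun r => by
      by_cases hr : r < s
      · simp [D, indicator, hr, mul_comm]
      · simp [D, indicator, hr, not_lt.1 hr]
    simp_rw [this]
    rw [integral_const_mul, integral_indicator measurableSet_Iio,
      Measure.restrict_restrict measurableSet_Iio,
      inter_eq_left.2 (Iio_subset_Iic_self.trans (Iic_subset_Iic.2 hs)),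
      setIntegral_congr_set Iio_ae_eq_Iic]
  rw [hmain, ← integral_add_compl hD hfg, h1, h2]

/-- Primitives of integrable functions are measurable. -/
theorem measurable_setIntegral_Iic {T : Type*} [LinearOrder T] [TopologicalSpace T]
    [OrderClosedTopology T] [SecondCountableTopology T] [MeasurableSpace T] [BorelSpace T]
    {m : Measure T} [IsFiniteMeasure m] {f : T → ℝ} (hf : Measurable f) :
    Measurable fun t => ∫ s in Iic t, f s ∂m := by
  have h : (fun t => ∫ s in Iic t, f s ∂m) =
      fun t => ∫ s, {p : T × T | p.2 ≤ p.1}.indicator (fun p => f p.2) (t, s) ∂m := by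
    funext t
    rw [← integral_indicator measurableSet_Iic]
    rfl
  rw [h]
  exact (((hf.comp measurable_snd).indicator
    (measurableSet_le measurable_snd measurable_fst)).stronglyMeasurable.integral_prod_right'
      ).measurable

/-! ### Coordinates of the iterated integrals as scalar integrals -/

variable {V : Type u} [NormedAddCommGroup V] [InnerProductSpace ℝ V] [FiniteDimensional ℝ V]
  {a b : ℝ} [Fact (a ≤ b)]

instance (x : BVPath V a b) : IsFiniteMeasure x.stieltjes.variation :=
  isFiniteMeasure_variation _

instance (x : BVPath V a b) : NullSingletonClass x.stieltjes.variation :=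
  ⟨x.variation_singleton⟩

/-- The density of the measure `⟪z, dx⟫` with respect to the variation of `dx`. -/
def BVPath.density (x : BVPath V a b) (z : V) : Icc a b → ℝ :=
  (exists_density x.stieltjes z).choose

theorem BVPath.measurable_density (x : BVPath V a b) (z : V) : Measurable (x.density z) :=
  (exists_density x.stieltjes z).choose_spec.1

theorem BVPath.abs_density_le (x : BVPath V a b) (z : V) (t : Icc a b) :
    |x.density z t| ≤ ‖z‖ :=
  (exists_density x.stieltjes z).choose_spec.2.1 t

theorem BVPath.inner_stieltjes (x : BVPath V a b) (z : V) (s : Set (Icc a b))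
    (hs : MeasurableSet s) :
    ⟪z, x.stieltjes s⟫_ℝ = ∫ t in s, x.density z t ∂x.stieltjes.variation :=
  (exists_density x.stieltjes z).choose_spec.2.2 s hs

theorem BVPath.integrable_mul_density (x : BVPath V a b) (z : V) {f : Icc a b → ℝ}
    (hf : Integrable f x.stieltjes.variation) :
    Integrable (fun t => f t * x.density z t) x.stieltjes.variation :=
  hf.mul_bdd (x.measurable_density z).aestronglyMeasurable
    (Filter.Eventually.of_forall fun t => x.abs_density_le z t)

/-- A pure tensor in a tensor power. -/
def tmulPow {k : ℕ} (u : TPow V k) (z : V) : TPow V (k + 1) := tensorMul V k u z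

theorem inner_tmulPow {k : ℕ} (u u' : TPow V k) (z z' : V) :
    ⟪tmulPow u z, tmulPow u' z'⟫_ℝ = ⟪u, u'⟫_ℝ * ⟪z, z'⟫_ℝ :=
  TensorProduct.inner_tmul ..

theorem tmulPow_induction {k : ℕ} {p : TPow V (k + 1) → Prop} (zero : p 0)
    (tmul : ∀ u z, p (tmulPow u z)) (add : ∀ v w, p v → p w → p (v + w)) (v : TPow V (k + 1)) :
    p v :=
  TensorProduct.induction_on (R := ℝ) (M := TPow V k) (N := V) (motive := p) v zero tmul add

theorem BVPath.norm_iterInt_le (x : BVPath V a b) (k : ℕ) :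
    ∃ C : ℝ, ∀ t, ‖x.iterInt k t‖ ≤ C := by
  refine ⟨x.stieltjes.variation.real univ ^ k / k.factorial, fun t => ?_⟩
  have h := x.enorm_iterInt_le k t
  rw [← ofReal_norm, ENNReal.ofReal_le_ofReal_iff (by positivity)] at h
  refine h.trans ?_
  gcongr
  exacts [measure_ne_top _ _, subset_univ _]

theorem BVPath.integrable_iterInt_of_stronglyMeasurable (x : BVPath V a b) (k : ℕ)
    (h : StronglyMeasurable (x.iterInt k)) :
    Integrable (x.iterInt k) x.stieltjes.variation := by
  obtain ⟨C, hC⟩ := x.norm_iterInt_le k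
  exact Integrable.of_bound h.aestronglyMeasurable C (Filter.Eventually.of_forall hC)

/-- Pairing with a pure tensor makes the bilinear map a product of two functionals, so the density
of `⟪z, dx⟫` can replace the vector measure. Integrability stays a hypothesis because its proof at
level `k + 1` uses this formula at level `k`. -/
theorem BVPath.inner_tmulPow_iterInt_of_integrable (x : BVPath V a b) (k : ℕ)
    (h : Integrable (x.iterInt k) x.stieltjes.variation) (u : TPow V k) (z : V) (t : Icc a b) :
    ⟪tmulPow u z, x.iterInt (k + 1) t⟫_ℝ =
      ∫ s in Iic t, ⟪u, x.iterInt k s⟫_ℝ * x.density z s ∂x.stieltjes.variation := by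
  have h1 : x.iterInt (k + 1) t =
      x.stieltjes.integral ((Iic t).indicator (x.iterInt k)) (tensorMul V k) :=
    (VectorMeasure.integral_indicator measurableSet_Iic).symm
  have hi := h.indicator (measurableSet_Iic (a := t))
  rw [h1]
  change (innerSL ℝ (tmulPow u z) : TPow V (k + 1) →L[ℝ] ℝ) _ = _
  rw [VectorMeasure.continuousLinearMap_apply_integral hi,
    integral_eq_integral_mul_density (l := innerSL ℝ u) (x.measurable_density z)
      (x.abs_density_le z) (x.inner_stieltjes z) (fun e v => inner_tmulPow u e z v) hi,
    ← integral_indicator measurableSet_Iic]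
  congr 1
  ext s
  by_cases hs : s ∈ Iic t <;> simp [hs]

theorem BVPath.stronglyMeasurable_iterInt (x : BVPath V a b) (k : ℕ) :
    StronglyMeasurable (x.iterInt k) := by
  induction k with
  | zero => exact stronglyMeasurable_const
  | succ k ih =>
    have hm : ∀ v : TPow V (k + 1), Measurable fun t => ⟪v, x.iterInt (k + 1) t⟫_ℝ := by
      refine tmulPow_induction ?_ ?_ ?_
      · simp
      · intro u z
        simp_rw [x.inner_tmulPow_iterInt_of_integrable k
          (x.integrable_iterInt_of_stronglyMeasurable k ih)]
        have hu : Measurable fun s => ⟪u, x.iterInt k s⟫_ℝ :=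
          ((innerSL ℝ u : TPow V k →L[ℝ] ℝ).continuous.comp_stronglyMeasurable ih).measurable
        exact measurable_setIntegral_Iic (hu.mul (x.measurable_density z))
      · intro v w hv hw
        simp_rw [inner_add_left]
        exact hv.add hw
    -- In finite dimension, measurability of all coordinates gives strong measurability.
    let e := stdOrthonormalBasis ℝ (TPow V (k + 1))
    have : x.iterInt (k + 1) = fun t => ∑ i, ⟪e i, x.iterInt (k + 1) t⟫_ℝ • e i :=
      funext fun t => (e.sum_repr' _).symm
    rw [this]
    exact Finset.stronglyMeasurable_fun_sum _ fun i _ =>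
      (hm (e i)).stronglyMeasurable.smul_const _

theorem BVPath.integrable_iterInt (x : BVPath V a b) (k : ℕ) :
    Integrable (x.iterInt k) x.stieltjes.variation :=
  x.integrable_iterInt_of_stronglyMeasurable k (x.stronglyMeasurable_iterInt k)

theorem BVPath.inner_tmulPow_iterInt (x : BVPath V a b) (k : ℕ) (u : TPow V k) (z : V)
    (t : Icc a b) :
    ⟪tmulPow u z, x.iterInt (k + 1) t⟫_ℝ =
      ∫ s in Iic t, ⟪u, x.iterInt k s⟫_ℝ * x.density z s ∂x.stieltjes.variation :=
  x.inner_tmulPow_iterInt_of_integrable k (x.integrable_iterInt k) u z t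

/-! ### The shuffle product -/

variable (V a b) in
/-- The coordinate iterated integrals at level `k`, as functions of the path and the end time. -/
def coordInt (k : ℕ) : TPow V k →ₗ[ℝ] (BVPath V a b × Icc a b → ℝ) where
  toFun v p := ⟪v, p.1.iterInt k p.2⟫_ℝ
  map_add' _ _ := funext fun _ => inner_add_left ..
  map_smul' _ _ := funext fun _ => real_inner_smul_left ..

variable (V a b) in
/-- The linear span of the coordinate iterated integrals. -/
def coordSpan : Submodule ℝ (BVPath V a b × Icc a b → ℝ) :=
  Submodule.span ℝ {f | ∃ (k : ℕ) (v : TPow V k), coordInt V a b k v = f}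

theorem coordInt_mem (k : ℕ) (v : TPow V k) : coordInt V a b k v ∈ coordSpan V a b :=
  Submodule.subset_span ⟨k, v, rfl⟩

theorem integrable_coordInt {k : ℕ} (v : TPow V k) (x : BVPath V a b) :
    Integrable (fun t => coordInt V a b k v (x, t)) x.stieltjes.variation :=
  (innerSL ℝ v : TPow V k →L[ℝ] ℝ).integrable_comp (x.integrable_iterInt k)

/-- The integral of a function on paths and times against the `z`-component of the path. -/
def integrate (z : V) (f : BVPath V a b × Icc a b → ℝ) (p : BVPath V a b × Icc a b) : ℝ :=
  ∫ s in Iic p.2, f (p.1, s) * p.1.density z s ∂p.1.stieltjes.variation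

theorem coordInt_tmulPow {k : ℕ} (u : TPow V k) (z : V) :
    coordInt V a b (k + 1) (tmulPow u z) = integrate z (coordInt V a b k u) :=
  funext fun p => p.1.inner_tmulPow_iterInt k u z p.2

/-- Integrability is carried through the induction because additivity of `integrate z` depends on
it. -/
theorem integrate_mem_coordSpan (z : V) {f : BVPath V a b × Icc a b → ℝ}
    (hf : f ∈ coordSpan V a b) :
    (∀ x : BVPath V a b, Integrable (fun t => f (x, t)) x.stieltjes.variation) ∧
      integrate z f ∈ coordSpan V a b := by
  induction hf using Submodule.span_induction with
  | mem f hf =>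
    obtain ⟨k, v, rfl⟩ := hf
    exact ⟨integrable_coordInt v, coordInt_tmulPow (a := a) (b := b) v z ▸ coordInt_mem _ _⟩
  | zero =>
    have : integrate z (0 : BVPath V a b × Icc a b → ℝ) = 0 := by
      ext p; simp [integrate]
    exact ⟨fun x => integrable_zero _ _ _, this.symm ▸ Submodule.zero_mem _⟩
  | add f g _ _ hf hg =>
    refine ⟨fun x => (hf.1 x).add (hg.1 x), ?_⟩
    have : integrate z (f + g) = integrate z f + integrate z g := by
      ext p
      simp only [integrate, Pi.add_apply, add_mul]
      exact integral_add (p.1.integrable_mul_density z (hf.1 p.1)).restrict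
        (p.1.integrable_mul_density z (hg.1 p.1)).restrict
    exact this ▸ Submodule.add_mem _ hf.2 hg.2
  | smul c f _ hf =>
    refine ⟨fun x => (hf.1 x).const_mul c, ?_⟩
    have : integrate z (c • f) = c • integrate z f := by
      ext p
      simp only [integrate, Pi.smul_apply, smul_eq_mul, mul_assoc]
      exact integral_const_mul _ _
    exact this ▸ Submodule.smul_mem _ c hf.2

/-- The recursive form of the shuffle product: integration by parts strips the last letter from one
factor or from the other. -/
theorem coordInt_tmulPow_mul {k l : ℕ} (u : TPow V k) (z : V) (u' : TPow V l) (z' : V) :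
    coordInt V a b (k + 1) (tmulPow u z) * coordInt V a b (l + 1) (tmulPow u' z') =
      integrate z (coordInt V a b k u * coordInt V a b (l + 1) (tmulPow u' z')) +
        integrate z' (coordInt V a b (k + 1) (tmulPow u z) * coordInt V a b l u') := by
  ext ⟨x, t⟩
  simp only [Pi.mul_apply, Pi.add_apply, coordInt_tmulPow]
  refine (setIntegral_Iic_mul_setIntegral_Iic (x.integrable_mul_density z (integrable_coordInt u x))
    (x.integrable_mul_density z' (integrable_coordInt u' x)) t).trans ?_
  congr 1
  · refine integral_congr_ae (Filter.Eventually.of_forall fun s => ?_)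
    simp only [Pi.mul_apply, integrate]
    ring
  · refine integral_congr_ae (Filter.Eventually.of_forall fun s => ?_)
    simp only [Pi.mul_apply, integrate]
    ring

theorem coordInt_zero_eq (v : TPow V 0) :
    coordInt V a b 0 v = fun _ => ⟪v, tensorUnit V⟫_ℝ := rfl

theorem coordInt_mul_mem {k l : ℕ} (v : TPow V k) (w : TPow V l) :
    coordInt V a b k v * coordInt V a b l w ∈ coordSpan V a b := by
  -- Stripping a letter from the first factor keeps the second at level `l + 1`, so the outer
  -- hypothesis must cover all `l`. Level zero is a scalar multiple, and bilinearity reduces the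
  -- remaining case to pure tensors.
  induction k generalizing l with
  | zero =>
    have : coordInt V a b 0 v * coordInt V a b l w =
        ⟪v, tensorUnit V⟫_ℝ • coordInt V a b l w := rfl
    exact this ▸ Submodule.smul_mem _ _ (coordInt_mem _ _)
  | succ k ihk =>
    induction l generalizing v with
    | zero =>
      have : coordInt V a b (k + 1) v * coordInt V a b 0 w =
          ⟪w, tensorUnit V⟫_ℝ • coordInt V a b (k + 1) v := by
        rw [mul_comm]; rfl
      exact this ▸ Submodule.smul_mem _ _ (coordInt_mem _ _)
    | succ l ihl =>
      induction v using tmulPow_induction with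
      | zero => rw [map_zero, zero_mul]; exact Submodule.zero_mem _
      | add v v' hv hv' =>
        rw [map_add, add_mul]
        exact Submodule.add_mem _ hv hv'
      | tmul u z =>
        induction w using tmulPow_induction with
        | zero => rw [map_zero, mul_zero]; exact Submodule.zero_mem _
        | add w w' hw hw' => rw [map_add, mul_add]; exact Submodule.add_mem _ hw hw'
        | tmul u' z' =>
          rw [coordInt_tmulPow_mul]
          exact Submodule.add_mem _ (integrate_mem_coordSpan z (ihk u _)).2
            (integrate_mem_coordSpan z' (ihl _ u')).2

/-- The shuffle property: the span of the coordinate iterated integrals is an algebra. -/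
theorem mul_mem_coordSpan {f g : BVPath V a b × Icc a b → ℝ} (hf : f ∈ coordSpan V a b)
    (hg : g ∈ coordSpan V a b) : f * g ∈ coordSpan V a b := by
  induction hf, hg using Submodule.span_induction₂ with
  | mem_mem f g hf hg =>
    obtain ⟨k, v, rfl⟩ := hf
    obtain ⟨l, w, rfl⟩ := hg
    exact coordInt_mul_mem v w
  | zero_left => simp
  | zero_right => simp
  | add_left _ _ _ _ _ _ h h' => rw [add_mul]; exact Submodule.add_mem _ h h'
  | add_right _ _ _ _ _ _ h h' => rw [mul_add]; exact Submodule.add_mem _ h h'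
  | smul_left c _ _ _ _ h => rw [smul_mul_assoc]; exact Submodule.smul_mem _ _ h
  | smul_right c _ _ _ _ h => rw [mul_smul_comm]; exact Submodule.smul_mem _ _ h

theorem one_mem_coordSpan : (1 : BVPath V a b × Icc a b → ℝ) ∈ coordSpan V a b := by
  have : coordInt V a b 0 (tensorUnit V) = 1 := by
    ext p
    rw [coordInt_zero_eq]
    change ⟪(EuclideanSpace.single PUnit.unit 1 : EuclideanSpace ℝ PUnit.{u + 1}),
      (EuclideanSpace.single PUnit.unit 1 : EuclideanSpace ℝ PUnit.{u + 1})⟫_ℝ = 1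
    simp
  exact this ▸ coordInt_mem _ _

/-! ### Functionals of the signature -/

/-- The tensor series concentrated at level `k`. -/
def WeightedTensor.single (φ : Weight) (k : ℕ) (v : TPow V k) : WeightedTensor V φ :=
  ⟨Pi.single k v, summable_of_ne_finset_zero (s := {k}) fun j hj => by
    have hj : j ≠ k := by simpa using hj
    simp [Pi.single_eq_of_ne hj]⟩

theorem WeightedTensor.inner_single (φ : Weight) (k : ℕ) (v : TPow V k)
    (w : WeightedTensor V φ) :
    ⟪WeightedTensor.single φ k v, w⟫_ℝ = φ k * ⟪v, w.coord k⟫_ℝ := by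
  rw [WeightedTensor.inner_def, tsum_eq_single k fun j hj => ?_]
  · simp [WeightedTensor.single, WeightedTensor.coord]
  · simp [WeightedTensor.single, WeightedTensor.coord, Pi.single_eq_of_ne hj]

/-- Exhibits each coordinate as a bounded functional of the signature in the weighted space, whence
its continuity; the inverse weight cancels `φ k`. -/
theorem inner_sig_eq (φ : Weight) (k : ℕ) (v : TPow V k) (x : UnparamPath V a b) :
    ⟪v, x.sig k⟫_ℝ = ⟪WeightedTensor.single φ k ((φ k)⁻¹ • v), signature φ x⟫_ℝ := by
  rw [WeightedTensor.inner_single, real_inner_smul_left, ← mul_assoc,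
    mul_inv_cancel₀ (φ.pos k).ne', one_mul]
  rfl

theorem UnparamPath.sig_injective :
    Function.Injective (UnparamPath.sig : UnparamPath V a b → (k : ℕ) → TPow V k) := by
  intro x y
  induction x using Quotient.inductionOn
  induction y using Quotient.inductionOn
  exact fun h => Quotient.sound h

theorem signature_injective (φ : Weight) :
    Function.Injective (signature φ : UnparamPath V a b → WeightedTensor V φ) :=
  fun _ _ h => UnparamPath.sig_injective (congrArg Subtype.val h)

/-- Restriction of functions of paths and times to the whole signature of the paths in `K`. -/
def evalTop (K : Set (UnparamPath V a b)) : (BVPath V a b × Icc a b → ℝ) →ₗ[ℝ] (K → ℝ) :=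
  LinearMap.funLeft ℝ ℝ fun x => (Quotient.out x.1, ⊤)

/-- The representative chosen by `Quotient.out` is immaterial, since the signature depends only on
the class. -/
theorem evalTop_coordInt (K : Set (UnparamPath V a b)) (k : ℕ) (v : TPow V k) :
    evalTop K (coordInt V a b k v) = fun x => ⟪v, x.1.sig k⟫_ℝ := by
  funext x
  conv_rhs => rw [← Quotient.out_eq x.1]
  rfl

theorem inner_kernelSection_right (φ : Weight) (f : SigRKHS V a b φ) (x : UnparamPath V a b) :
    ⟪f, kernelSection φ x⟫_ℝ = f x := by
  rw [kernelSection, RKHS.inner_kerFun]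
  simp

/-! ### Continuity and the Stone–Weierstrass algebra -/

variable [TopologicalSpace (UnparamPath V a b)]

/-- The algebra of continuous functions on `K` which are linear functionals of the signature. -/
def sigAlgebra (K : Set (UnparamPath V a b)) : Subalgebra ℝ C(K, ℝ) :=
  (((coordSpan V a b).map (evalTop K)).comap
    (ContinuousMap.coeFnLinearMap ℝ : C(K, ℝ) →ₗ[ℝ] K → ℝ)).toSubalgebra
    ⟨1, one_mem_coordSpan, rfl⟩
    (by
      rintro f g ⟨f', hf', hf⟩ ⟨g', hg', hg⟩
      refine ⟨f' * g', mul_mem_coordSpan hf' hg', ?_⟩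
      change evalTop K f' * evalTop K g' = _
      rw [hf, hg]
      rfl)

theorem mem_sigAlgebra {K : Set (UnparamPath V a b)} {f : C(K, ℝ)} :
    f ∈ sigAlgebra K ↔ ∃ g ∈ coordSpan V a b, evalTop K g = f := Iff.rfl

theorem continuous_inner_sig {φ : Weight}
    (hS : Continuous (signature φ : UnparamPath V a b → WeightedTensor V φ)) (k : ℕ)
    (v : TPow V k) : Continuous fun x : UnparamPath V a b => ⟪v, x.sig k⟫_ℝ := by
  simp_rw [inner_sig_eq φ]
  exact continuous_const.inner hS

theorem separatesPoints_sigAlgebra {φ : Weight}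
    (hS : Continuous (signature φ : UnparamPath V a b → WeightedTensor V φ))
    (K : Set (UnparamPath V a b)) : (sigAlgebra K).SeparatesPoints := by
  intro x y hxy
  have h : ∃ k, x.1.sig k ≠ y.1.sig k := by
    by_contra! h
    exact hxy (Subtype.ext (UnparamPath.sig_injective (funext h)))
  obtain ⟨k, hk⟩ := h
  -- Equal values at `x` and `y` of the coordinate along this difference would force its square norm
  -- to vanish.
  let v := x.1.sig k - y.1.sig k
  let f : C(K, ℝ) := ⟨fun x => ⟪v, x.1.sig k⟫_ℝ,
    (continuous_inner_sig hS k v).comp continuous_subtype_val⟩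
  refine ⟨f, ⟨f, mem_sigAlgebra.2 ⟨_, coordInt_mem k v, evalTop_coordInt K k v⟩, rfl⟩, fun h => ?_⟩
  have h' : ⟪v, v⟫_ℝ = 0 := (inner_sub_right _ _ _).trans (sub_eq_zero.2 h)
  exact hk (sub_eq_zero.1 (inner_self_eq_zero.1 h'))

/-- Kernel sections and signatures have the same pairwise inner products, hence the same distances.
-/
theorem continuous_kernelSection {φ : Weight}
    (hS : Continuous (signature φ : UnparamPath V a b → WeightedTensor V φ)) :
    Continuous (kernelSection φ : UnparamPath V a b → SigRKHS V a b φ) := by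
  have hd : ∀ x y, dist (kernelSection φ x) (kernelSection φ y : SigRKHS V a b φ) =
      dist (signature φ x) (signature φ y) := fun x y => by
    rw [dist_eq_norm, dist_eq_norm, ← sq_eq_sq₀ (norm_nonneg _) (norm_nonneg _),
      norm_sub_sq_real, norm_sub_sq_real, ← real_inner_self_eq_norm_sq,
      ← real_inner_self_eq_norm_sq, ← real_inner_self_eq_norm_sq, ← real_inner_self_eq_norm_sq]
    simp only [inner_kernelSection, sigKernel]
  refine continuous_iff_continuousAt.2 fun x => tendsto_iff_dist_tendsto_zero.2 ?_
  simp_rw [hd]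
  exact tendsto_iff_dist_tendsto_zero.1 (hS.tendsto x)

/-! ### Measures on compact sets of paths -/

variable [MeasurableSpace (UnparamPath V a b)] [BorelSpace (UnparamPath V a b)]
  {K : Set (UnparamPath V a b)}

theorem integrable_of_continuous_of_isCompact (hK : IsCompact K) {E : Type*}
    [NormedAddCommGroup E] {f : K → E} (hf : Continuous f) (μ : Measure K) [IsFiniteMeasure μ] :
    Integrable f μ := by
  have := isCompact_iff_compactSpace.1 hK
  exact hf.integrable_of_hasCompactSupport (HasCompactSupport.of_compactSpace f)

/-- Expected signatures determine measures on compact sets of unparameterised paths. -/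
theorem eq_of_integral_inner_sig_eq {φ : Weight}
    (hS : Continuous (signature φ : UnparamPath V a b → WeightedTensor V φ)) (hK : IsCompact K)
    {μ ν : Measure K} [IsFiniteMeasure μ] [IsFiniteMeasure ν]
    (h : ∀ (k : ℕ) (v : TPow V k),
      ∫ x : K, ⟪v, x.1.sig k⟫_ℝ ∂μ = ∫ x : K, ⟪v, x.1.sig k⟫_ℝ ∂ν) : μ = ν := by
  have hcomp := isCompact_iff_compactSpace.1 hK
  -- A continuous injection of a compact space into a Hausdorff one is a closed embedding, so `K` is
  -- metrizable; its finite Borel measures are then determined by integrals of bounded continuous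
  -- functions.
  have hSK : Topology.IsClosedEmbedding fun x : K => signature φ x.1 :=
    (hS.comp continuous_subtype_val).isClosedEmbedding
      ((signature_injective φ).comp Subtype.val_injective)
  have := hSK.isEmbedding.metrizableSpace
  have hspan : ∀ g ∈ coordSpan V a b, Integrable (evalTop K g) μ ∧ Integrable (evalTop K g) ν ∧
      ∫ x, evalTop K g x ∂μ = ∫ x, evalTop K g x ∂ν := by
    intro g hg
    induction hg using Submodule.span_induction with
    | mem g hg =>
      obtain ⟨k, v, rfl⟩ := hg
      rw [evalTop_coordInt]
      have hc := (continuous_inner_sig hS k v).comp (continuous_subtype_val (p := (· ∈ K)))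
      exact ⟨integrable_of_continuous_of_isCompact hK hc μ,
        integrable_of_continuous_of_isCompact hK hc ν, h k v⟩
    | zero =>
      rw [map_zero]
      exact ⟨integrable_zero _ _ _, integrable_zero _ _ _, by simp⟩
    | add f g _ _ hf hg =>
      rw [map_add]
      exact ⟨hf.1.add hg.1, hf.2.1.add hg.2.1, by
        rw [integral_add' hf.1 hg.1, integral_add' hf.2.1 hg.2.1, hf.2.2, hg.2.2]⟩
    | smul c f _ hf =>
      rw [map_smul]
      exact ⟨hf.1.smul c, hf.2.1.smul c, by
        simp only [Pi.smul_apply, integral_smul, hf.2.2]⟩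
  have hdense := ContinuousMap.subalgebra_topologicalClosure_eq_top_of_separatesPoints
    (sigAlgebra K) (separatesPoints_sigAlgebra hS K)
  have hcont : ∀ (m : Measure K) [IsFiniteMeasure m],
      Continuous fun f : C(K, ℝ) => ∫ x, f x ∂m := fun m _ =>
    continuous_iff_continuousAt.2 fun f₀ => by
      -- The constant dominates every `f` whose norm is below `‖f₀‖ + 1`, which holds near `f₀`.
      refine tendsto_integral_filter_of_dominated_convergence (fun _ => ‖f₀‖ + 1) ?_ ?_
        (integrable_const _) (Filter.Eventually.of_forall fun x =>
          ((continuous_eval_const x).tendsto f₀))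
      · exact Filter.Eventually.of_forall fun f =>
          (integrable_of_continuous_of_isCompact hK f.continuous m).aestronglyMeasurable
      · filter_upwards [(continuous_norm.tendsto f₀).eventually
          (gt_mem_nhds (lt_add_one ‖f₀‖))] with f hf
        exact Filter.Eventually.of_forall fun x => (f.norm_coe_le_norm x).trans hf.le
  have hall : ∀ f : C(K, ℝ), ∫ x, f x ∂μ = ∫ x, f x ∂ν := by
    intro f
    have hf : f ∈ closure (sigAlgebra K : Set C(K, ℝ)) := by
      rw [← Subalgebra.topologicalClosure_coe, hdense]
      exact mem_univ f
    refine closure_minimal (t := {f : C(K, ℝ) | ∫ x, f x ∂μ = ∫ x, f x ∂ν}) ?_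
      (isClosed_eq (hcont μ) (hcont ν)) hf
    rintro f hf
    obtain ⟨g, hg, hgf⟩ := mem_sigAlgebra.1 hf
    have := (hspan g hg).2.2
    rw [hgf] at this
    exact this
  exact ext_of_forall_integral_eq_of_IsFiniteMeasure fun f => hall f.toContinuousMap

/-- Measures with the same kernel averages have the same expected signature. -/
theorem integral_inner_sig_eq_of_integral_sigKernel_eq {φ : Weight}
    (hS : Continuous (signature φ : UnparamPath V a b → WeightedTensor V φ)) (hK : IsCompact K)
    {μ ν : Measure K} [IsFiniteMeasure μ] [IsFiniteMeasure ν]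
    (h : ∀ x : K, ∫ y : K, sigKernel φ x.1 y.1 ∂μ = ∫ y : K, sigKernel φ x.1 y.1 ∂ν)
    (k : ℕ) (v : TPow V k) :
    ∫ x : K, ⟪v, x.1.sig k⟫_ℝ ∂μ = ∫ x : K, ⟪v, x.1.sig k⟫_ℝ ∂ν := by
  -- Bochner integrals need a complete target. The completion preserves inner products, so
  -- completeness of the weighted space itself plays no role.
  let s : K → UniformSpace.Completion (WeightedTensor V φ) := fun x => signature φ x.1
  have hs : Continuous s :=
    (UniformSpace.Completion.continuous_coe _).comp (hS.comp continuous_subtype_val)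
  have hi : ∀ (m : Measure K) [IsFiniteMeasure m], Integrable s m := fun m _ =>
    integrable_of_continuous_of_isCompact hK hs m
  have hinner : ∀ (m : Measure K) [IsFiniteMeasure m] (w),
      ∫ x, ⟪w, s x⟫_ℝ ∂m = ⟪w, ∫ x, s x ∂m⟫_ℝ := fun m _ w => integral_inner (hi m) w
  let d := ∫ x, s x ∂μ - ∫ x, s x ∂ν
  have hsd : ∀ x, ⟪d, s x⟫_ℝ = 0 := fun x => by
    rw [real_inner_comm, inner_sub_right, ← hinner μ, ← hinner ν, sub_eq_zero]
    simpa only [s, UniformSpace.Completion.inner_coe, sigKernel] using h x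
  -- `d` is orthogonal to every `s x`, hence to integrals of `s`, hence to itself.
  have hd : d = 0 := by
    rw [← inner_self_eq_zero (𝕜 := ℝ)]
    change ⟪d, ∫ x, s x ∂μ - ∫ x, s x ∂ν⟫_ℝ = 0
    rw [inner_sub_right, ← hinner μ, ← hinner ν]
    simp [hsd]
  have hsig : ∀ x : K, ⟪v, x.1.sig k⟫_ℝ =
      ⟪(WeightedTensor.single φ k ((φ k)⁻¹ • v) :
        UniformSpace.Completion (WeightedTensor V φ)), s x⟫_ℝ := fun x => by
    rw [inner_sig_eq φ, UniformSpace.Completion.inner_coe]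
  simp_rw [hsig]
  rw [hinner μ, hinner ν, sub_eq_zero.1 hd]

/-! ### Kernel mean embedding and maximum mean discrepancy -/

theorem integrable_kernelSection {φ : Weight}
    (hS : Continuous (signature φ : UnparamPath V a b → WeightedTensor V φ)) (hK : IsCompact K)
    (μ : Measure K) [IsFiniteMeasure μ] :
    Integrable (fun x : K => kernelSection φ (x : UnparamPath V a b)) μ :=
  integrable_of_continuous_of_isCompact hK
    ((continuous_kernelSection hS).comp continuous_subtype_val) μ

theorem integrable_rkhs {φ : Weight}
    (hS : Continuous (signature φ : UnparamPath V a b → WeightedTensor V φ)) (hK : IsCompact K)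
    (f : SigRKHS V a b φ) (μ : Measure K) [IsFiniteMeasure μ] :
    Integrable (fun x : K => f x) μ := by
  simp_rw [← inner_kernelSection_right φ f]
  exact (integrable_kernelSection hS hK μ).const_inner f

theorem integral_rkhs {φ : Weight}
    (hS : Continuous (signature φ : UnparamPath V a b → WeightedTensor V φ)) (hK : IsCompact K)
    (f : SigRKHS V a b φ) (μ : ProbabilityMeasure K) :
    ∫ x : K, f x ∂(μ : Measure K) = ⟪f, kernelMean φ μ⟫_ℝ := by
  simp_rw [← inner_kernelSection_right φ f]
  exact integral_inner (integrable_kernelSection hS hK _) f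

/-- Pairing a kernel mean with the section at `x` returns the average of the kernel at `x`, so equal
embeddings have equal kernel averages, hence equal expected signatures. -/
theorem isCharacteristic {φ : Weight}
    (hS : Continuous (signature φ : UnparamPath V a b → WeightedTensor V φ))
    (hK : IsCompact K) : IsCharacteristic K φ := by
  intro μ ν h
  refine Subtype.ext (eq_of_integral_inner_sig_eq (μ := (μ : Measure K)) (ν := (ν : Measure K)) hS hK fun k v =>
    integral_inner_sig_eq_of_integral_sigKernel_eq hS hK (fun x => ?_) k v)
  have hm : ∀ m : ProbabilityMeasure K, ∫ y : K, sigKernel φ x.1 y.1 ∂(m : Measure K) =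
      ⟪kernelSection φ (x : UnparamPath V a b), kernelMean φ m⟫_ℝ := fun m => by
    rw [← integral_rkhs hS hK]
    refine integral_congr_ae (Filter.Eventually.of_forall fun y => ?_)
    exact (kernelSection_apply φ _ _).symm
  exact (hm μ).trans ((congrArg _ h).trans (hm ν).symm)

theorem mmdSet_eq {φ : Weight}
    (hS : Continuous (signature φ : UnparamPath V a b → WeightedTensor V φ)) (hK : IsCompact K)
    (μ ν : ProbabilityMeasure K) :
    mmdSet φ μ ν = (fun f => ⟪f, kernelMean φ μ - kernelMean φ ν⟫_ℝ) '' {f | ‖f‖ ≤ 1} := by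
  refine image_congr fun f _ => ?_
  rw [integral_rkhs hS hK, integral_rkhs hS hK, inner_sub_right]

theorem bddAbove_mmdSet {φ : Weight}
    (hS : Continuous (signature φ : UnparamPath V a b → WeightedTensor V φ)) (hK : IsCompact K)
    (μ ν : ProbabilityMeasure K) : BddAbove (mmdSet φ μ ν) := by
  rw [mmdSet_eq hS hK]
  refine ⟨‖kernelMean φ μ - kernelMean φ ν‖, ?_⟩
  rintro _ ⟨f, hf, rfl⟩
  exact (real_inner_le_norm _ _).trans (mul_le_of_le_one_left (norm_nonneg _) hf)

/-- The maximum mean discrepancy is the distance of the kernel mean embeddings. -/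
theorem mmd_eq_norm {φ : Weight}
    (hS : Continuous (signature φ : UnparamPath V a b → WeightedTensor V φ)) (hK : IsCompact K)
    (μ ν : ProbabilityMeasure K) : mmd φ μ ν = ‖kernelMean φ μ - kernelMean φ ν‖ := by
  refine IsLUB.csSup_eq ⟨?_, fun c hc => ?_⟩ ⟨_, 0, by simp, rfl⟩
  · rw [mmdSet_eq hS hK]
    rintro _ ⟨f, hf, rfl⟩
    exact (real_inner_le_norm _ _).trans (mul_le_of_le_one_left (norm_nonneg _) hf)
  · rw [mmdSet_eq hS hK] at hc
    set d := kernelMean φ μ - kernelMean φ ν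
    -- The normalised difference attains the supremum. For `d = 0` the convention `0⁻¹ = 0` makes it
    -- the zero function, still in the unit ball.
    have h := hc ⟨‖d‖⁻¹ • d, by
      rw [mem_ofPred_eq, norm_smul, norm_inv, norm_norm]; exact inv_mul_le_one, rfl⟩
    simp only [real_inner_smul_left, real_inner_self_eq_norm_sq] at h
    rcases eq_or_ne ‖d‖ 0 with h0 | h0
    · rw [h0] at h ⊢; simpa using h
    · rwa [pow_two, inv_mul_cancel_left₀ h0] at h

end SignatureKernel
end

open SignatureKernel in
theorem mainTheorem8 {V : Type*} [NormedAddCommGroup V] [InnerProductSpace ℝ V]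
    [FiniteDimensional ℝ V] (a b : ℝ) [Fact (a ≤ b)] (φ : Weight)
    [TopologicalSpace (UnparamPath V a b)] [MeasurableSpace (UnparamPath V a b)]
    [BorelSpace (UnparamPath V a b)]
    (hS : Continuous (signature φ : UnparamPath V a b → WeightedTensor V φ))
    (K : Set (UnparamPath V a b)) (hK : IsCompact K) :
    (∀ μ ν : ProbabilityMeasure K,
      (∀ f : SigRKHS V a b φ,
        Integrable (fun x : K => f x) (μ : Measure K) ∧
          Integrable (fun x : K => f x) (ν : Measure K)) ∧
      BddAbove (mmdSet φ μ ν) ∧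
      (mmd φ μ ν = 0 ↔ μ = ν)) ∧
    (∀ μ : ProbabilityMeasure K,
      Integrable (fun x : K => kernelSection φ (x : UnparamPath V a b)) (μ : Measure K)) ∧
    IsCharacteristic K φ := by
  refine ⟨fun μ ν => ⟨fun f => ⟨integrable_rkhs hS hK f _, integrable_rkhs hS hK f _⟩,
    bddAbove_mmdSet hS hK μ ν, ?_⟩, fun μ => integrable_kernelSection hS hK _,
    isCharacteristic hS hK⟩
  rw [mmd_eq_norm hS hK, norm_eq_zero, sub_eq_zero]
  exact (isCharacteristic hS hK).eq_iff
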